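/- Let $\mathcal G=(\mathcal V,\mathcal E)$ be a finite connected undirected graph; for $i\in\mathcal V$ let $V_i=\{i\}\cup\{j:(i,j)\in\mathcal E\}$, and suppose that $\mathrm{card}(V_i)=V$ for all $i$. Write $|x|=\sum_i|x_i|$. Let $(A(n))_n$ be i.i.d. random vectors in $\mathbb N^{\mathcal V}$ (with possibly dependent coordinates) such that $\mathbf E A_i(n)=\lambda>0$ for all $i$. For each $x\in\mathbb N^{\mathcal V}$ let $W^x=(W^x(n))_{n\ge 0}$ be the process with $W^x(0)=x$ and $$W_i^x(n+1)=W^x_i(n)+A_i(n+1)-\mathbf 1(N^x_i(n)=1)\prod_{j\in V_i\setminus\{i\}}\mathbf 1(N^x_j(n)=0),$$ where, conditionally on $A(1),\dots,A(n),N^x(0),\dots,N^x(n-1)$, the variables $N^x_i(n)$, $i\in\mathcal V$, are independent and $N^x_i(n)$ is binomial with parameters $\bigl(W^x_i(n),\,1/\sum_{j\in V_i}W^x_j(n)\bigr)$ (so that $N_i^x(n)=0$ if $W_i^x(n)=0$), and where $A(n+1)$ is independent of $A(1),\dots,A(n),N^x(0),\dots,N^x(n)$. All these processes are defined on one probability space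 and use the same arrivals $A$; the joint law of the $N^x$ for different $x$ is arbitrary. For a sequence $(x^n)$ in $\mathbb N^{\mathcal V}$ with $|x^n|\to\infty$ put $X^n(t)=W^{x^n}(\lceil |x^n|t\rceil)/|x^n|$, $t\ge 0$. A fluid limit is an accumulation point $z$, with càdlàg paths, of such a sequence $(X^n)$ in the Skorokhod topology. If $\lambda<e^{-1}/V$, then the fluid model is stable: there is a deterministic time $t_0$ with $z(t)=0$ a.s. for all $t\ge t_0$, for every fluid limit $z$. This holds for accumulation points of the sample paths as well as for limits in law. That is, there is $t_0\ge0$ such that for every sequence $(x^n)$ with $|x^n|\to\infty$: (a) almost surely, every accumulation point $z$ of the sequence of paths $(X^n)$ satisfies $z(t)=0$ for all $t\ge t_0$; (b) every random process $z$ (on any probability space) which is the limit in distribution of a subsequence of $(X^n)$ satisfies, almost surely, $z(t)=0$ for all $t\ge t_0$. -/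

import Mathlib

open MeasureTheory ProbabilityTheory Filter Topology
open scoped NNReal ENNReal

noncomputable section

/-! ### The Skorokhod path space -/

/-- Paths `[0, ∞) → ℝ^ι`.  A type synonym which carries the Skorokhod (pseudo-)distance below, and
not the product topology. -/
def SkorokhodPath (ι : Type*) : Type _ := ℝ≥0 → ι → ℝ

namespace SkorokhodPath

variable {ι : Type*} [Fintype ι]

/-- The cost on `[0, T]` of the time change `g`,
`sup_{t ∈ [0,T]} (|g(t) - t| + |f₁(g(t)) - f₂(t)|)`, with the `L¹` norm on `ℝ^ι`.  An order
isomorphism of `[0, T]` is the same as a continuous strictly increasing map of `[0, T]` onto itself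
with `g(0) = 0` and `g(T) = T`. -/
def timeChangeCost (T : ℝ≥0) (f₁ f₂ : SkorokhodPath ι) (g : Set.Icc 0 T ≃o Set.Icc 0 T) : ℝ≥0∞ :=
  ⨆ t : Set.Icc 0 T,
    ENNReal.ofReal (|(((g t : ℝ≥0) : ℝ) - ((t : ℝ≥0) : ℝ))| + ∑ i, |f₁ (g t) i - f₂ t i|)

/-- The Skorokhod distance on `[0, T]`. -/
def distOn (T : ℝ≥0) (f₁ f₂ : SkorokhodPath ι) : ℝ≥0∞ :=
  ⨅ g : Set.Icc 0 T ≃o Set.Icc 0 T, timeChangeCost T f₁ f₂ g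

/-- The function `x ↦ x / (1 + x) = 1 - 1 / (1 + x)`, with value `1` at `∞`. -/
def squash (x : ℝ≥0∞) : ℝ≥0∞ := 1 - (1 + x)⁻¹

/-- The Skorokhod distance on `[0, ∞)`: `∑_{T ≥ 1} 2^{-T} d_T / (1 + d_T)`. -/
def skorokhodDist (f₁ f₂ : SkorokhodPath ι) : ℝ≥0∞ :=
  ∑' n : ℕ, (2⁻¹ : ℝ≥0∞) ^ (n + 1) * squash (distOn ((n : ℝ≥0) + 1) f₁ f₂)

lemma squash_zero : squash 0 = 0 := by simp [squash]

lemma squash_mono : Monotone squash := by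
  intro a b hab
  unfold squash
  gcongr

lemma squash_of_ne_top {a : ℝ≥0∞} (ha : a ≠ ∞) :
    squash a = ENNReal.ofReal (a.toReal / (1 + a.toReal)) := by
  obtain ⟨r, rfl⟩ : ∃ r : ℝ≥0, a = r := ⟨a.toNNReal, (ENNReal.coe_toNNReal ha).symm⟩
  have h1 : (1 + (r : ℝ≥0∞))⁻¹ = ENNReal.ofReal ((1 + (r : ℝ))⁻¹) := by
    rw [ENNReal.ofReal_inv_of_pos (by positivity), ENNReal.ofReal_add (by simp) (by simp)]
    simp
  unfold squash
  rw [h1, ← ENNReal.ofReal_one, ← ENNReal.ofReal_sub _ (by positivity)]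
  congr 1
  have : (1 + (r : ℝ)) ≠ 0 := by positivity
  simp only [ENNReal.coe_toReal]
  field_simp
  ring

lemma squash_add_le (a b : ℝ≥0∞) : squash (a + b) ≤ squash a + squash b := by
  by_cases ha : a = ∞
  · subst ha; simp [squash]
  by_cases hb : b = ∞
  · subst hb; simp [squash]
  rw [squash_of_ne_top ha, squash_of_ne_top hb,
    squash_of_ne_top (ENNReal.add_ne_top.2 ⟨ha, hb⟩), ENNReal.toReal_add ha hb,
    ← ENNReal.ofReal_add (by positivity) (by positivity)]
  apply ENNReal.ofReal_le_ofReal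
  have h1 : 0 ≤ a.toReal := ENNReal.toReal_nonneg
  have h2 : 0 ≤ b.toReal := ENNReal.toReal_nonneg
  generalize a.toReal = x at *
  generalize b.toReal = y at *
  rw [add_div]
  gcongr <;> linarith

lemma distOn_self (T : ℝ≥0) (f : SkorokhodPath ι) : distOn T f f = 0 := by
  refine le_antisymm (iInf_le_of_le (OrderIso.refl _) ?_) bot_le
  simp [timeChangeCost]

lemma distOn_comm_le (T : ℝ≥0) (f₁ f₂ : SkorokhodPath ι) : distOn T f₁ f₂ ≤ distOn T f₂ f₁ := by
  refine le_iInf fun g => iInf_le_of_le g.symm (iSup_le fun t => ?_)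
  refine le_iSup_of_le (g.symm t) (le_of_eq ?_)
  simp only [OrderIso.apply_symm_apply]
  rw [abs_sub_comm]
  simp only [abs_sub_comm]

lemma distOn_triangle (T : ℝ≥0) (f₁ f₂ f₃ : SkorokhodPath ι) :
    distOn T f₁ f₃ ≤ distOn T f₁ f₂ + distOn T f₂ f₃ := by
  unfold distOn
  simp only [ENNReal.iInf_add, ENNReal.add_iInf]
  refine le_iInf fun h => le_iInf fun g => ?_
  refine iInf_le_of_le (h.trans g) (iSup_le fun t => ?_)
  refine le_trans ?_ (add_le_add (le_iSup _ (h t)) (le_iSup _ t))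
  rw [← ENNReal.ofReal_add (by positivity) (by positivity)]
  apply ENNReal.ofReal_le_ofReal
  simp only [OrderIso.trans_apply]
  have h1 := abs_sub_le (((g (h t) : ℝ≥0) : ℝ)) ((h t : ℝ≥0) : ℝ) ((t : ℝ≥0) : ℝ)
  have h2 : ∑ i, |f₁ (g (h t)) i - f₃ t i|
      ≤ ∑ i, |f₁ (g (h t)) i - f₂ (h t) i| + ∑ i, |f₂ (h t) i - f₃ t i| := by
    rw [← Finset.sum_add_distrib]
    exact Finset.sum_le_sum fun i _ => abs_sub_le _ _ _
  linarith

instance : PseudoEMetricSpace (SkorokhodPath ι) where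
  edist := skorokhodDist
  edist_self f := by simp [skorokhodDist, distOn_self, squash_zero]
  edist_comm f₁ f₂ := by
    have h : ∀ T, distOn T f₁ f₂ = distOn T f₂ f₁ := fun T =>
      le_antisymm (distOn_comm_le T f₁ f₂) (distOn_comm_le T f₂ f₁)
    simp [skorokhodDist, h]
  edist_triangle f₁ f₂ f₃ := by
    unfold skorokhodDist
    rw [← ENNReal.tsum_add]
    refine ENNReal.tsum_le_tsum fun n => ?_
    rw [← mul_add]
    gcongr
    exact (squash_mono (distOn_triangle _ f₁ f₂ f₃)).trans (squash_add_le _ _)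

instance : MeasurableSpace (SkorokhodPath ι) := borel _

instance : BorelSpace (SkorokhodPath ι) := ⟨rfl⟩

/-- Right-continuous with left limits. -/
def IsCadlag (z : SkorokhodPath ι) : Prop :=
  ∀ t : ℝ≥0, ∀ i,
    ContinuousWithinAt (fun s => z s i) (Set.Ici t) t ∧
      ∃ l : ℝ, Tendsto (fun s => z s i) (𝓝[<] t) (𝓝 l)

end SkorokhodPath

/-! ### The spatial ALOHA protocol -/

namespace SpatialAloha

variable {ι : Type*} [Fintype ι] [DecidableEq ι] (G : SimpleGraph ι) [DecidableRel G.Adj]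

/-- The neighbourhood `V_i = {i} ∪ {j : (i, j) is an edge}`. -/
def nbhd (i : ι) : Finset ι := insert i (G.neighborFinset i)

/-- `1` if exactly one user at `i` and no user at any other vertex of `V_i` attempts transmission,
when `m j` users attempt transmission at `j`; otherwise `0`. -/
def success (m : ι → ℕ) (i : ι) : ℕ :=
  if m i = 1 ∧ ∀ j ∈ nbhd G i \ {i}, m j = 0 then 1 else 0

/-- The numbers of users `W(n)`, for the initial state `x`, numbers of arrivals `a 1, a 2, …` and
numbers of transmission attempts `m 0, m 1, …`.  (Below, `m n i` never exceeds the number of users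
at `i` almost surely, so that the subtraction does not truncate.) -/
def workload (x : ι → ℕ) (a m : ℕ → ι → ℕ) : ℕ → ι → ℕ
  | 0 => x
  | n + 1 => fun i => workload x a m n i + a (n + 1) i - success G (m n) i

/-- The probability with which a user at vertex `i` attempts transmission when the numbers of users
are `w`. -/
def attemptProb (w : ι → ℕ) (i : ι) : ℝ := 1 / ∑ j ∈ nbhd G i, (w j : ℝ)

/-- The probability that a binomial random variable with parameters `(n, p)` equals `k`. -/
def binomialWeight (n : ℕ) (p : ℝ) (k : ℕ) : ℝ := (n.choose k : ℝ) * p ^ k * (1 - p) ^ (n - k)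

variable {Ω : Type*} [MeasurableSpace Ω]

/-- The workload process `W^x`, built from the arrivals `A` and from the numbers `N x n i` of users
attempting transmission at time `n` at vertex `i` in the system started at `x`. -/
def W (A : ℕ → Ω → ι → ℕ) (N : (ι → ℕ) → ℕ → Ω → ι → ℕ) (x : ι → ℕ) (n : ℕ) (ω : Ω) : ι → ℕ :=
  workload G x (fun k => A k ω) (fun k => N x k ω) n

/-- The history of the system started at `x` when the attempts at time `n` are about to be made: it
is generated by `A(1), …, A(n)` and `N^x(0), …, N^x(n-1)`. -/
abbrev history (A : ℕ → Ω → ι → ℕ) (N : (ι → ℕ) → ℕ → Ω → ι → ℕ) (x : ι → ℕ) (n : ℕ) :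
    MeasurableSpace Ω :=
  (⨆ k ∈ Set.Icc 1 n, MeasurableSpace.comap (A k) inferInstance) ⊔
    (⨆ k ∈ Set.Iio n, MeasurableSpace.comap (N x k) inferInstance)

/-- The protocol on the graph `G`, for all the initial states `x`, with the same arrivals.  Nothing
is assumed about the joint law of the attempts in the systems with different initial states. -/
structure IsModel (lam : ι → ℝ) (μ : Measure Ω) (A : ℕ → Ω → ι → ℕ)
    (N : (ι → ℕ) → ℕ → Ω → ι → ℕ) : Prop where
  /-- the arrivals `A(n)` are i.i.d. random vectors; the coordinates may be dependent -/
  measurable_arrivals : ∀ n, Measurable (A n)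
  indep_arrivals : iIndepFun A μ
  ident_arrivals : ∀ n, IdentDistrib (A n) (A 0) μ μ
  /-- the mean number of arrivals at `i` is `lam i > 0` -/
  integrable_arrivals : ∀ n i, Integrable (fun ω => (A n ω i : ℝ)) μ
  mean_arrivals : ∀ n i, ∫ ω, (A n ω i : ℝ) ∂μ = lam i
  lam_pos : ∀ i, 0 < lam i
  measurable_attempts : ∀ x n, Measurable (N x n)
  /-- given the history, the `N_i(n)` are independent and binomial with parameters
  `(W_i(n), 1 / ∑_{j ∈ V_i} W_j(n))` -/
  attempts_law : ∀ (x : ι → ℕ) (n : ℕ) (m : ι → ℕ),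
    μ[(N x n ⁻¹' {m}).indicator (fun _ => (1 : ℝ)) | history A N x n]
      =ᵐ[μ] fun ω => ∏ i, binomialWeight (W G A N x n ω i) (attemptProb G (W G A N x n ω) i) (m i)
  /-- the arrivals at time `n + 1` are independent of everything that happened before -/
  arrivals_indep_past : ∀ (x : ι → ℕ) (n : ℕ),
    Indep (MeasurableSpace.comap (A (n + 1)) inferInstance)
      (history A N x n ⊔ MeasurableSpace.comap (N x n) inferInstance) μ

/-- The `L¹` norm `|x|` of a state. -/
def size (x : ι → ℕ) : ℕ := ∑ i, x i

/-- The scaled path `t ↦ W^x(⌈|x| t⌉) / |x|`. -/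
def scaledPath (A : ℕ → Ω → ι → ℕ) (N : (ι → ℕ) → ℕ → Ω → ι → ℕ) (x : ι → ℕ) (ω : Ω) :
    SkorokhodPath ι :=
  fun t i => (W G A N x ⌈(size x : ℝ≥0) * t⌉₊ ω i : ℝ) / (size x : ℝ)

/-- `z` is a fluid limit, along the sequence `x` of initial states, at the sample point `ω`: it is
an accumulation point, in the Skorokhod topology, of the scaled sample paths. -/
def IsSampleFluidLimit (A : ℕ → Ω → ι → ℕ) (N : (ι → ℕ) → ℕ → Ω → ι → ℕ) (x : ℕ → ι → ℕ) (ω : Ω)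
    (z : SkorokhodPath ι) : Prop :=
  z.IsCadlag ∧ MapClusterPt z atTop (fun n => scaledPath G A N (x n) ω)

/-- The random process `z`, on any probability space, is a fluid limit in law along the sequence `x`
of initial states: it has càdlàg paths, and some subsequence of the scaled processes converges to it
in distribution for the Skorokhod topology. -/
def IsFluidLimitInLaw (μ : Measure Ω) [IsProbabilityMeasure μ] (A : ℕ → Ω → ι → ℕ)
    (N : (ι → ℕ) → ℕ → Ω → ι → ℕ) (x : ℕ → ι → ℕ) {Ω' : Type*} [MeasurableSpace Ω']
    (μ' : Measure Ω') [IsProbabilityMeasure μ'] (z : Ω' → SkorokhodPath ι) : Prop :=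
  (∀ ω', (z ω').IsCadlag) ∧
    ∃ φ : ℕ → ℕ, StrictMono φ ∧
      TendstoInDistribution (fun k => scaledPath G A N (x (φ k))) atTop z (fun _ => μ) μ'

end SpatialAloha

end

open MeasureTheory ProbabilityTheory Filter Topology
open scoped NNReal ENNReal

set_option linter.unusedSectionVars false

noncomputable section

namespace SpatialAloha

section Drift

variable {ι : Type*} [Fintype ι] [DecidableEq ι] (G : SimpleGraph ι) [DecidableRel G.Adj]

/-- The sum of `u` over the neighbourhood `V_i`. -/
def nbhdSum (u : ι → ℝ) (i : ι) : ℝ := ∑ j ∈ nbhd G i, u j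

/-- The probability of a successful transmission at `i` when the numbers of users are `w`. -/
def successProb (w : ι → ℕ) (i : ι) : ℝ :=
  binomialWeight (w i) (attemptProb G w i) 1 *
    ∏ j ∈ nbhd G i \ {i}, binomialWeight (w j) (attemptProb G w j) 0

lemma mem_nbhd_self (i : ι) : i ∈ nbhd G i := by simp [nbhd]

lemma mem_nbhd_comm {i j : ι} : j ∈ nbhd G i ↔ i ∈ nbhd G j := by
  simp only [nbhd, Finset.mem_insert, SimpleGraph.mem_neighborFinset]
  rw [G.adj_comm, eq_comm]

lemma sum_nbhd_comm (f : ι → ι → ℝ) :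
    ∑ i, ∑ j ∈ nbhd G i, f i j = ∑ j, ∑ i ∈ nbhd G j, f i j :=
  Finset.sum_comm' fun i j => by simpa using mem_nbhd_comm G

lemma sum_nbhd_sdiff_comm (f : ι → ι → ℝ) :
    ∑ i, ∑ j ∈ nbhd G i \ {i}, f i j = ∑ j, ∑ i ∈ nbhd G j \ {j}, f i j :=
  Finset.sum_comm' fun i j => by
    simp only [Finset.mem_univ, true_and, and_true, Finset.mem_sdiff, Finset.mem_singleton]
    rw [mem_nbhd_comm G, eq_comm]

lemma sum_nbhdSum {V : ℕ} (hV : ∀ i, (nbhd G i).card = V) (u : ι → ℝ) :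
    ∑ i, nbhdSum G u i = V * ∑ i, u i := by
  simp only [nbhdSum]
  rw [sum_nbhd_comm]
  simp [hV, Finset.mul_sum]

lemma sum_nbhdSum_mul_comm (u v : ι → ℝ) :
    ∑ i, nbhdSum G u i * v i = ∑ i, nbhdSum G v i * u i := by
  simp only [nbhdSum, Finset.sum_mul]
  rw [sum_nbhd_comm]
  exact Finset.sum_congr rfl fun i _ => Finset.sum_congr rfl fun j _ => mul_comm _ _

lemma nbhdSum_nonneg {u : ι → ℝ} (hu : ∀ i, 0 ≤ u i) (i : ι) : 0 ≤ nbhdSum G u i :=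
  Finset.sum_nonneg fun j _ => hu j

lemma le_nbhdSum {u : ι → ℝ} (hu : ∀ i, 0 ≤ u i) (i : ι) : u i ≤ nbhdSum G u i :=
  Finset.single_le_sum (f := u) (fun j _ => hu j) (mem_nbhd_self G i)

lemma binomialWeight_nonneg {p : ℝ} (h0 : 0 ≤ p) (h1 : p ≤ 1) (n k : ℕ) :
    0 ≤ binomialWeight n p k := by
  unfold binomialWeight
  have : 0 ≤ 1 - p := by linarith
  positivity

lemma attemptProb_nonneg (w : ι → ℕ) (i : ι) : 0 ≤ attemptProb G w i := by
  unfold attemptProb; positivity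

lemma attemptProb_le_one (w : ι → ℕ) (i : ι) : attemptProb G w i ≤ 1 := by
  unfold attemptProb
  rw [← Nat.cast_sum, one_div]
  exact Nat.cast_inv_le_one _

lemma successProb_nonneg (w : ι → ℕ) (i : ι) : 0 ≤ successProb G w i :=
  mul_nonneg (binomialWeight_nonneg (attemptProb_nonneg G w i) (attemptProb_le_one G w i) _ _)
    (Finset.prod_nonneg fun j _ =>
      binomialWeight_nonneg (attemptProb_nonneg G w j) (attemptProb_le_one G w j) _ _)

lemma exp_neg_div_le_one_sub_inv_pow {s : ℝ} (hs : 1 < s) (n : ℕ) :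
    Real.exp (-(n / (s - 1))) ≤ (1 - 1 / s) ^ n := by
  have h : Real.exp (-(1 / (s - 1))) ≤ 1 - 1 / s := by
    have h1 : 0 < s - 1 := by linarith
    have h2 := Real.add_one_le_exp (1 / (s - 1))
    rw [Real.exp_neg]
    refine inv_le_of_inv_le₀ (by rw [sub_pos, div_lt_one (by linarith)]; exact hs) (le_trans (le_of_eq ?_) h2)
    have : s ≠ 0 := by linarith
    field_simp
    ring
  calc Real.exp (-(n / (s - 1))) = Real.exp (-(1 / (s - 1))) ^ n := by
        rw [← Real.exp_nat_mul]; congr 1; ring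
    _ ≤ _ := pow_le_pow_left₀ (Real.exp_nonneg _) h n

lemma mul_exp_le_nbhdSum_mul_successProb (w : ι → ℕ) (i : ι) :
    (w i : ℝ) * Real.exp (-(((w i : ℝ) - 1) / (nbhdSum G (fun j => w j) i - 1) +
        ∑ j ∈ nbhd G i \ {i}, (w j : ℝ) / (nbhdSum G (fun k => w k) j - 1)))
      ≤ nbhdSum G (fun j => w j) i * successProb G w i := by
  have hw : ∀ j, (0 : ℝ) ≤ (w j : ℝ) := fun j => Nat.cast_nonneg _
  rcases Nat.eq_zero_or_pos (w i) with h0 | h0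
  · rw [h0]
    simp only [Nat.cast_zero, zero_mul]
    exact mul_nonneg (nbhdSum_nonneg G hw i) (successProb_nonneg G w i)
  have hS : (1 : ℝ) ≤ nbhdSum G (fun j => w j) i :=
    le_trans (by exact_mod_cast h0) (le_nbhdSum G hw i)
  have hp : ∀ j, attemptProb G w j = 1 / nbhdSum G (fun k => w k) j := fun j => rfl
  have hown : Real.exp (-(((w i : ℝ) - 1) / (nbhdSum G (fun j => w j) i - 1)))
      ≤ (1 - 1 / nbhdSum G (fun j => w j) i) ^ (w i - 1) := by
    rcases hS.eq_or_lt with h1 | h1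
    · have : w i = 1 := by
        refine le_antisymm ?_ h0
        have := le_nbhdSum G hw i
        rw [← h1] at this
        exact_mod_cast this
      simp [this]
    · have := exp_neg_div_le_one_sub_inv_pow h1 (w i - 1)
      rwa [Nat.cast_sub h0, Nat.cast_one] at this
  have hother : ∀ j ∈ nbhd G i \ {i}, Real.exp (-((w j : ℝ) / (nbhdSum G (fun k => w k) j - 1)))
      ≤ (1 - 1 / nbhdSum G (fun k => w k) j) ^ (w j) := by
    intro j hj
    rcases Nat.eq_zero_or_pos (w j) with hj0 | hj0
    · simp [hj0]
    apply exp_neg_div_le_one_sub_inv_pow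
    simp only [Finset.mem_sdiff, Finset.mem_singleton] at hj
    have h2 : (w i : ℝ) + w j ≤ nbhdSum G (fun k => w k) j := by
      rw [← Finset.sum_pair (f := fun k => (w k : ℝ)) (Ne.symm hj.2)]
      refine Finset.sum_le_sum_of_subset_of_nonneg ?_ fun k _ _ => hw k
      intro k hk
      simp only [Finset.mem_insert, Finset.mem_singleton] at hk
      rcases hk with rfl | rfl
      · exact (mem_nbhd_comm G).1 hj.1
      · exact mem_nbhd_self G _
    have h3 : (1 : ℝ) ≤ w i := by exact_mod_cast h0
    have h4 : (1 : ℝ) ≤ w j := by exact_mod_cast hj0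
    linarith
  have hprod : Real.exp (-∑ j ∈ nbhd G i \ {i}, (w j : ℝ) / (nbhdSum G (fun k => w k) j - 1))
      ≤ ∏ j ∈ nbhd G i \ {i}, (1 - 1 / nbhdSum G (fun k => w k) j) ^ (w j) := by
    rw [← Finset.sum_neg_distrib, Real.exp_sum]
    exact Finset.prod_le_prod (fun _ _ => Real.exp_nonneg _) hother
  have hq : nbhdSum G (fun j => w j) i * successProb G w i
      = w i * ((1 - 1 / nbhdSum G (fun j => w j) i) ^ (w i - 1) *
        ∏ j ∈ nbhd G i \ {i}, (1 - 1 / nbhdSum G (fun k => w k) j) ^ (w j)) := by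
    unfold successProb binomialWeight
    simp only [hp, Nat.choose_one_right, Nat.choose_zero_right, pow_one, pow_zero, Nat.cast_one,
      one_mul, Nat.sub_zero]
    field_simp
  rw [hq, neg_add, Real.exp_add]
  gcongr
  exact le_trans (Real.exp_nonneg _) hown

/-- The drift inequality for the quadratic Lyapunov function `w ↦ ∑ i, w i * ∑ j ∈ V_i, w j`. -/
theorem exp_neg_one_mul_sum_le (w : ι → ℕ) :
    Real.exp (-1) * ∑ i, (w i : ℝ)
      ≤ ∑ i, nbhdSum G (fun j => w j) i * successProb G w i := by
  set S : ι → ℝ := nbhdSum G (fun j => w j) with hSdef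
  set E : ι → ℝ := fun i => ((w i : ℝ) - 1) / (S i - 1) +
        ∑ j ∈ nbhd G i \ {i}, (w j : ℝ) / (S j - 1) with hE
  have htangent : ∀ e : ℝ, Real.exp (-1) * (2 - e) ≤ Real.exp (-e) := by
    intro e
    have := Real.add_one_le_exp (1 - e)
    calc Real.exp (-1) * (2 - e) ≤ Real.exp (-1) * Real.exp (1 - e) := by
          gcongr; linarith
      _ = _ := by rw [← Real.exp_add]; congr 1; ring
  have hsum : ∑ i, (w i : ℝ) * E i ≤ ∑ i, (w i : ℝ) := by
    have h1 : ∑ i, (w i : ℝ) * E i = ∑ i, (w i : ℝ) * ((S i - 1) / (S i - 1)) := by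
      simp only [hE, mul_add, Finset.sum_add_distrib, Finset.mul_sum]
      rw [sum_nbhd_sdiff_comm, ← Finset.sum_add_distrib]
      refine Finset.sum_congr rfl fun i _ => ?_
      have h2 : ∑ j ∈ nbhd G i \ {i}, (w j : ℝ) = S i - w i := by
        rw [Finset.sum_sdiff_eq_sub (by simpa using mem_nbhd_self G i)]
        simp [hSdef, nbhdSum]
      rw [← Finset.sum_mul, h2]
      ring
    rw [h1]
    exact Finset.sum_le_sum fun i _ => mul_le_of_le_one_right (Nat.cast_nonneg _) (div_self_le_one _)
  calc Real.exp (-1) * ∑ i, (w i : ℝ)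
      ≤ Real.exp (-1) * (2 * ∑ i, (w i : ℝ) - ∑ i, (w i : ℝ) * E i) := by gcongr; linarith
    _ = ∑ i, (w i : ℝ) * (Real.exp (-1) * (2 - E i)) := by
        rw [Finset.mul_sum, ← Finset.sum_sub_distrib, Finset.mul_sum]
        exact Finset.sum_congr rfl fun i _ => by ring
    _ ≤ ∑ i, (w i : ℝ) * Real.exp (-E i) := by
        gcongr with i
        exact htangent _
    _ ≤ _ := Finset.sum_le_sum fun i _ => mul_exp_le_nbhdSum_mul_successProb G w i

end Drift
section Deterministic

variable {ι : Type*} [Fintype ι] [DecidableEq ι] (G : SimpleGraph ι) [DecidableRel G.Adj]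

lemma abs_sum_nbhdSum_mul_le (u v : ι → ℝ) :
    |∑ i, nbhdSum G u i * v i| ≤ (∑ i, |u i|) * ∑ i, |v i| := by
  rw [Finset.mul_sum]
  refine (Finset.abs_sum_le_sum_abs _ _).trans (Finset.sum_le_sum fun i _ => ?_)
  rw [abs_mul]
  gcongr
  exact (Finset.abs_sum_le_sum_abs _ _).trans
    (Finset.sum_le_sum_of_subset_of_nonneg (Finset.subset_univ _) fun j _ _ => abs_nonneg _)

/-- The quadratic Lyapunov function. -/
def energy (u : ι → ℝ) : ℝ := ∑ i, nbhdSum G u i * u i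

lemma energy_add (u v : ι → ℝ) :
    energy G (fun i => u i + v i) = energy G u + 2 * ∑ i, nbhdSum G u i * v i + energy G v := by
  have h := sum_nbhdSum_mul_comm G u v
  have h2 : ∀ i, nbhdSum G (fun i => u i + v i) i = nbhdSum G u i + nbhdSum G v i :=
    fun i => Finset.sum_add_distrib
  simp only [energy, h2, add_mul, mul_add, Finset.sum_add_distrib]
  rw [← h]
  ring

lemma energy_le_sq (u : ι → ℝ) : energy G u ≤ (∑ i, |u i|) ^ 2 :=
  (le_abs_self _).trans ((abs_sum_nbhdSum_mul_le G u u).trans (le_of_eq (sq _).symm))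

lemma sq_sum_le_card_mul_energy {u : ι → ℝ} (hu : ∀ i, 0 ≤ u i) :
    (∑ i, u i) ^ 2 ≤ Fintype.card ι * energy G u := by
  refine sq_sum_le_card_mul_sum_sq.trans ?_
  rw [Finset.card_univ]
  gcongr
  refine Finset.sum_le_sum fun i _ => ?_
  rw [sq]
  exact mul_le_mul_of_nonneg_right (le_nbhdSum G hu i) (hu i)

lemma le_sq_max_of_step {Y R : ℕ → ℝ} {δ a g B M : ℝ} {n : ℕ} (hδ : 0 < δ) (hM : 0 ≤ M)
    (h0 : Y 0 ≤ M ^ 2) (hB : δ / 2 ≤ B) (hg1 : 2 * δ * a + g ≤ δ * B) (hg2 : 2 * δ * a + g ≤ B ^ 2)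
    (hR : ∀ k < n, 0 ≤ R k + a) (hY : ∀ k < n, Y k ≤ (R k + a) ^ 2)
    (hstep : ∀ k < n, Y (k + 1) ≤ Y k - 2 * δ * R k + g) :
    ∀ k ≤ n, Y k ≤ (max (M - δ / 2 * k) B) ^ 2 := by
  intro k
  induction k with
  | zero =>
    intro _
    refine h0.trans (pow_le_pow_left₀ hM ?_ 2)
    simp
  | succ k ih =>
    intro hk
    have hk' : k < n := hk
    have ih' := ih hk'.le
    set b := max (M - δ / 2 * k) B with hb
    have hBb : B ≤ b := le_max_right _ _
    have hb' : b - δ / 2 ≤ max (M - δ / 2 * ((k + 1 : ℕ) : ℝ)) B := by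
      rw [hb, sub_le_iff_le_add]
      refine max_le ?_ ?_
      · have := le_max_left (M - δ / 2 * ((k + 1 : ℕ) : ℝ)) B
        push_cast at this ⊢
        linarith
      · have := le_max_right (M - δ / 2 * ((k + 1 : ℕ) : ℝ)) B
        linarith
    have hBm : B ≤ max (M - δ / 2 * ((k + 1 : ℕ) : ℝ)) B := le_max_right _ _
    have hs := hstep k hk'
    have hYk := hY k hk'
    have hRk := hR k hk'
    have hdb : δ * B ≤ δ * b := by gcongr
    have key : (b - δ / 2) ^ 2 ≤ (max (M - δ / 2 * ((k + 1 : ℕ) : ℝ)) B) ^ 2 :=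
      pow_le_pow_left₀ (by linarith) hb' 2
    have keyB : B ^ 2 ≤ (max (M - δ / 2 * ((k + 1 : ℕ) : ℝ)) B) ^ 2 :=
      pow_le_pow_left₀ (by linarith) hBm 2
    rcases le_or_gt b (R k + a) with h | h
    · refine le_trans ?_ key
      nlinarith
    · rcases le_or_gt (R k + a) (2 * δ) with h2 | h2
      · refine le_trans ?_ keyB
        nlinarith
      · refine le_trans ?_ key
        have : 0 ≤ (b - (R k + a)) * (b + (R k + a) - 2 * δ) :=
          mul_nonneg (by linarith) (by linarith)
        nlinarith

lemma le_of_sq_le_quadratic {K R a B H : ℝ} (hK : 1 ≤ K) (hR : 0 ≤ R) (ha : 0 ≤ a) (hB : 0 ≤ B)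
    (hKB : K * B ≤ H / 2) (hKa : K * a ≤ H / 8)
    (h : R ^ 2 ≤ K * (B ^ 2 + 2 * (R * a) + a * a)) : R ≤ H := by
  have e1 : K * B ^ 2 ≤ (H / 2) ^ 2 :=
    calc K * B ^ 2 ≤ K * (K * B ^ 2) := le_mul_of_one_le_left (by positivity) hK
      _ = (K * B) ^ 2 := by ring
      _ ≤ (H / 2) ^ 2 := pow_le_pow_left₀ (by positivity) hKB 2
  have e2 : R * (K * a) ≤ R * (H / 8) := mul_le_mul_of_nonneg_left hKa hR
  have e3 : K * a ^ 2 ≤ (H / 8) ^ 2 :=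
    calc K * a ^ 2 ≤ K * (K * a ^ 2) := le_mul_of_one_le_left (by positivity) hK
      _ = (K * a) ^ 2 := by ring
      _ ≤ (H / 8) ^ 2 := pow_le_pow_left₀ (by positivity) hKa 2
  have hH : 0 ≤ H := by
    have : 0 ≤ K * a := by positivity
    linarith
  by_contra! hcon
  nlinarith

set_option maxHeartbeats 800000 in
theorem exists_sum_le_of_fluid_approximation [Nonempty ι] {V : ℕ}
    (hV : ∀ i, (nbhd G i).card = V) {lam δ η : ℝ} (hlam : 0 < lam)
    (hδ : 0 < δ) (hδV : δ = Real.exp (-1) - lam * V) (hη : 0 < η) :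
    ∃ ε > 0, ∃ m₀ : ℕ, ∀ m ≥ m₀, ∀ (w : ℕ → ι → ℕ) (q : ℕ → ι → ℝ) (n : ℕ),
      size (w 0) = m → (∀ l < n, ∀ i, q l i ≤ 1) →
      (∀ l < n, ∀ i, successProb G (w l) i ≤ q l i) →
      (∀ k ≤ n, ∀ i,
        |(w k i : ℝ) - (w 0 i + lam * k - ∑ l ∈ Finset.range k, q l i)| ≤ ε * m) →
      ∀ k ≤ n, 2 * m / δ ≤ k → ∑ i, (w k i : ℝ) ≤ η * m := by
  set K : ℝ := ((Fintype.card ι : ℕ) : ℝ) with hK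
  have hK1 : 1 ≤ K := by rw [hK]; exact_mod_cast Fintype.card_pos
  set C : ℝ := lam + 1 with hC
  set θ : ℝ := η / (2 * K) with hθ
  have hθ0 : 0 < θ := by positivity
  set ε : ℝ := min (δ * θ / (2 * (2 * δ * K + 2 * K * (K * C)))) (η / (8 * K ^ 2)) with hε
  have hC0 : 0 < C := by positivity
  have hε0 : 0 < ε := by positivity
  refine ⟨ε, hε0, max 1 (max ⌈δ / θ⌉₊ ⌈2 * (K * C) ^ 2 / (δ * θ)⌉₊), ?_⟩
  intro m hm w q n hw0 hq1 hqs herr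
  have hm1 : (1 : ℝ) ≤ m := by exact_mod_cast (le_max_left _ _).trans hm
  have hm2 : δ / θ ≤ m :=
    (Nat.ceil_le).1 (((le_max_left _ _).trans (le_max_right _ _)).trans hm)
  have hm3 : 2 * (K * C) ^ 2 / (δ * θ) ≤ m :=
    (Nat.ceil_le).1 (((le_max_right _ _).trans (le_max_right _ _)).trans hm)
  rw [div_le_iff₀ hθ0] at hm2
  rw [div_le_iff₀ (by positivity)] at hm3
  have hq0 : ∀ l < n, ∀ i, 0 ≤ q l i := fun l hl i =>
    (successProb_nonneg G _ _).trans (hqs l hl i)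
  set u : ℕ → ι → ℝ := fun k i => w 0 i + lam * k - ∑ l ∈ Finset.range k, q l i with hu
  set e : ℕ → ι → ℝ := fun k i => (w k i : ℝ) - u k i with he
  set R : ℕ → ℝ := fun k => ∑ i, (w k i : ℝ) with hRdef
  set a : ℝ := K * (ε * m) with ha
  have ha0 : 0 < a := by positivity
  have hR0 : ∀ k, 0 ≤ R k := fun k => Finset.sum_nonneg fun i _ => Nat.cast_nonneg _
  have hRabs : ∀ k, ∑ i, |(w k i : ℝ)| = R k := fun k => by simp [hRdef]
  have hR00 : R 0 = m := by
    rw [← hw0]; simp [hRdef, size]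
  have hesum : ∀ k ≤ n, ∑ i, |e k i| ≤ a := by
    intro k hk
    calc ∑ i, |e k i| ≤ ∑ _i : ι, ε * m := Finset.sum_le_sum fun i _ => herr k hk i
      _ = a := by simp [ha, hK]
  have hY : ∀ k ≤ n, energy G (u k) ≤ (R k + a) ^ 2 := by
    intro k hk
    refine (energy_le_sq G _).trans (pow_le_pow_left₀ (by positivity) ?_ 2)
    calc ∑ i, |u k i| ≤ ∑ i, (|(w k i : ℝ)| + |e k i|) := by
          refine Finset.sum_le_sum fun i _ => ?_
          have : u k i = w k i - e k i := by simp [he]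
          rw [this]
          exact abs_sub _ _
      _ ≤ R k + a := by
          rw [Finset.sum_add_distrib, hRabs]
          gcongr
          exact hesum k hk
  have hΔ : ∀ k < n, ∑ i, |lam - q k i| ≤ K * C := by
    intro k hk
    calc ∑ i, |lam - q k i| ≤ ∑ _i : ι, C := Finset.sum_le_sum fun i _ => by
          have h1 := hq0 k hk i
          have h2 := hq1 k hk i
          rw [abs_le]; constructor <;> linarith
      _ = K * C := by simp [hK]
  have hstep : ∀ k < n, energy G (u (k + 1)) ≤
      energy G (u k) - 2 * δ * R k + (2 * a * (K * C) + (K * C) ^ 2) := by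
    intro k hk
    have h1 : u (k + 1) = fun i => u k i + (lam - q k i) := by
      funext i
      simp only [hu, Finset.sum_range_succ]
      push_cast
      ring
    rw [h1, energy_add]
    have h2 : energy G (fun i => lam - q k i) ≤ (K * C) ^ 2 :=
      (energy_le_sq G _).trans (pow_le_pow_left₀ (by positivity) (hΔ k hk) 2)
    have h3 : ∑ i, nbhdSum G (u k) i * (lam - q k i)
        = ∑ i, nbhdSum G (fun j => w k j) i * (lam - q k i)
          - ∑ i, nbhdSum G (e k) i * (lam - q k i) := by
      rw [← Finset.sum_sub_distrib]
      refine Finset.sum_congr rfl fun i _ => ?_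
      rw [← sub_mul]
      congr 1
      simp [nbhdSum, he]
    have h4 : |∑ i, nbhdSum G (e k) i * (lam - q k i)| ≤ a * (K * C) :=
      (abs_sum_nbhdSum_mul_le G _ _).trans
        (mul_le_mul (hesum k hk.le) (hΔ k hk) (by positivity) ha0.le)
    have h5 : ∑ i, nbhdSum G (fun j => (w k j : ℝ)) i * (lam - q k i) ≤ -δ * R k := by
      have h6 := sum_nbhdSum G hV (fun j => (w k j : ℝ))
      have h7 := exp_neg_one_mul_sum_le G (w k)
      have h8 : ∑ i, nbhdSum G (fun j => (w k j : ℝ)) i * successProb G (w k) i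
          ≤ ∑ i, nbhdSum G (fun j => (w k j : ℝ)) i * q k i := by
        refine Finset.sum_le_sum fun i _ => mul_le_mul_of_nonneg_left (hqs k hk i) ?_
        exact nbhdSum_nonneg G (fun _ => Nat.cast_nonneg _) _
      simp only [mul_sub, Finset.sum_sub_distrib, ← Finset.sum_mul]
      rw [h6, hδV]
      simp only [hRdef]
      linarith
    have h9 := (abs_le.1 h4).1
    linarith
  have hεδ : 2 * (2 * δ * K + 2 * K * (K * C)) * ε ≤ δ * θ := by
    have := min_le_left (δ * θ / (2 * (2 * δ * K + 2 * K * (K * C)))) (η / (8 * K ^ 2))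
    rw [← hε, le_div_iff₀ (by positivity)] at this
    linarith
  have hεη : 8 * K ^ 2 * ε ≤ η := by
    have := min_le_right (δ * θ / (2 * (2 * δ * K + 2 * K * (K * C)))) (η / (8 * K ^ 2))
    rw [← hε, le_div_iff₀ (by positivity)] at this
    linarith
  have hg1 : 2 * δ * a + (2 * a * (K * C) + (K * C) ^ 2) ≤ δ * (θ * m) := by
    have h1 : 2 * (2 * δ * K + 2 * K * (K * C)) * ε * m ≤ δ * θ * m := by gcongr
    have h2 : 2 * δ * a + 2 * a * (K * C) = (2 * δ * K + 2 * K * (K * C)) * ε * m := by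
      rw [ha]; ring
    linarith
  have hB : δ ≤ θ * m := by linarith
  have hmain := le_sq_max_of_step (Y := fun k => energy G (u k)) (R := R) (δ := δ) (a := a)
    (g := 2 * a * (K * C) + (K * C) ^ 2) (B := θ * m) (M := m) (n := n) hδ (by positivity)
    (by
      refine (energy_le_sq G _).trans (le_of_eq ?_)
      simp only [hu]
      simp only [Finset.range_zero, Finset.sum_empty, Nat.cast_zero, mul_zero, add_zero, sub_zero]
      rw [hRabs, hR00])
    (by linarith) hg1
    (hg1.trans (by rw [sq]; exact mul_le_mul_of_nonneg_right hB (by positivity)))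
    (fun k _ => by have := hR0 k; linarith) (fun k hk => hY k hk.le) hstep
  intro k hk hkδ
  have hk1 : energy G (u k) ≤ (θ * m) ^ 2 := by
    have := hmain k hk
    rwa [max_eq_right] at this
    rw [div_le_iff₀ hδ] at hkδ
    have : 0 < θ * m := by positivity
    linarith
  change R k ≤ η * m
  have h1 : energy G (u k) = energy G (fun i => (w k i : ℝ))
      + 2 * ∑ i, nbhdSum G (fun j => (w k j : ℝ)) i * (-e k i) + energy G (fun i => -e k i) := by
    rw [← energy_add]
    congr 1
    funext i
    simp [he]
  have h2 : |∑ i, nbhdSum G (fun j => (w k j : ℝ)) i * (-e k i)| ≤ R k * a := by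
    refine (abs_sum_nbhdSum_mul_le G _ _).trans ?_
    rw [hRabs]
    simp only [abs_neg]
    exact mul_le_mul_of_nonneg_left (hesum k hk) (hR0 k)
  have h3 : |energy G (fun i => -e k i)| ≤ a * a := by
    refine (abs_sum_nbhdSum_mul_le G _ _).trans ?_
    simp only [abs_neg]
    exact mul_le_mul (hesum k hk) (hesum k hk) (by positivity) ha0.le
  have h4 := sq_sum_le_card_mul_energy G (u := fun i => (w k i : ℝ)) (fun i => Nat.cast_nonneg _)
  change (R k) ^ 2 ≤ K * _ at h4
  have h5 : energy G (fun i => (w k i : ℝ)) ≤ (θ * m) ^ 2 + 2 * (R k * a) + a * a := by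
    have := (abs_le.1 h2).1
    have := (abs_le.1 h3).1
    linarith
  refine le_of_sq_le_quadratic (B := θ * m) hK1 (hR0 k) ha0.le (by positivity) (le_of_eq ?_) ?_
    (h4.trans (mul_le_mul_of_nonneg_left h5 (by positivity)))
  · rw [hθ]; field_simp
  · have : 8 * K ^ 2 * ε * m ≤ η * m := mul_le_mul_of_nonneg_right hεη (by positivity)
    rw [ha]
    linarith

end Deterministic
section Concentration

variable {Ω : Type*} [mΩ : MeasurableSpace Ω] {μ : Measure Ω}

/-- The partial sums of `D l - E[D l | ℱ l]`. -/
def centeredSum (μ : Measure Ω) (ℱ : ℕ → MeasurableSpace Ω) (D : ℕ → Ω → ℝ) (n : ℕ) (ω : Ω) : ℝ :=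
  ∑ l ∈ Finset.range n, (D l ω - (μ[D l | ℱ l]) ω)

variable {ℱ : ℕ → MeasurableSpace Ω} {D : ℕ → Ω → ℝ}

lemma stronglyMeasurable_centeredSum (hmono : Monotone ℱ)
    (hD : ∀ n, StronglyMeasurable[ℱ (n + 1)] (D n)) (n : ℕ) :
    StronglyMeasurable[ℱ n] (centeredSum μ ℱ D n) := by
  have : centeredSum μ ℱ D n = fun ω => ∑ l ∈ Finset.range n, (D l ω - (μ[D l | ℱ l]) ω) := rfl
  rw [this]
  refine Finset.stronglyMeasurable_fun_sum _ fun l hl => ?_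
  have hl' : l < n := Finset.mem_range.1 hl
  exact ((hD l).mono (hmono hl')).sub (stronglyMeasurable_condExp.mono (hmono hl'.le))

variable [IsProbabilityMeasure μ]

lemma integrable_of_mem_Icc (hle : ∀ n, ℱ n ≤ mΩ)
    (hD : ∀ n, StronglyMeasurable[ℱ (n + 1)] (D n)) (h0 : ∀ n ω, 0 ≤ D n ω)
    (h1 : ∀ n ω, D n ω ≤ 1) (n : ℕ) : Integrable (D n) μ :=
  Integrable.of_bound ((hD n).mono (hle _)).aestronglyMeasurable 1
    (Eventually.of_forall fun ω => by
      rw [Real.norm_eq_abs, abs_le]; constructor <;> linarith [h0 n ω, h1 n ω])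

lemma condExp_le_one (hle : ∀ n, ℱ n ≤ mΩ)
    (hD : ∀ n, StronglyMeasurable[ℱ (n + 1)] (D n)) (h0 : ∀ n ω, 0 ≤ D n ω)
    (h1 : ∀ n ω, D n ω ≤ 1) (n : ℕ) : ∀ᵐ ω ∂μ, (μ[D n | ℱ n]) ω ≤ 1 := by
  have h := condExp_mono (m := ℱ n) (integrable_of_mem_Icc hle hD h0 h1 n)
    (integrable_const (μ := μ) (1 : ℝ)) (Eventually.of_forall (h1 n))
  rw [condExp_const (hle n)] at h
  exact h

lemma abs_sub_condExp_le_one (hle : ∀ n, ℱ n ≤ mΩ)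
    (hD : ∀ n, StronglyMeasurable[ℱ (n + 1)] (D n)) (h0 : ∀ n ω, 0 ≤ D n ω)
    (h1 : ∀ n ω, D n ω ≤ 1) (n : ℕ) : ∀ᵐ ω ∂μ, |D n ω - (μ[D n | ℱ n]) ω| ≤ 1 := by
  have h := condExp_nonneg (μ := μ) (m := ℱ n) (Eventually.of_forall (h0 n) : 0 ≤ᵐ[μ] D n)
  filter_upwards [h, condExp_le_one hle hD h0 h1 n] with ω ha hb
  have ha' : 0 ≤ (μ[D n | ℱ n]) ω := ha
  rw [abs_le]
  constructor <;> linarith [h0 n ω, h1 n ω]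

lemma abs_centeredSum_le (hle : ∀ n, ℱ n ≤ mΩ)
    (hD : ∀ n, StronglyMeasurable[ℱ (n + 1)] (D n)) (h0 : ∀ n ω, 0 ≤ D n ω)
    (h1 : ∀ n ω, D n ω ≤ 1) (n : ℕ) : ∀ᵐ ω ∂μ, |centeredSum μ ℱ D n ω| ≤ n := by
  filter_upwards [ae_all_iff.2 (abs_sub_condExp_le_one (μ := μ) hle hD h0 h1)] with ω h
  refine (Finset.abs_sum_le_sum_abs _ _).trans ((Finset.sum_le_sum fun l _ => h l).trans ?_)
  simp

lemma integrable_exp_mul_centeredSum (hmono : Monotone ℱ) (hle : ∀ n, ℱ n ≤ mΩ)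
    (hD : ∀ n, StronglyMeasurable[ℱ (n + 1)] (D n)) (h0 : ∀ n ω, 0 ≤ D n ω)
    (h1 : ∀ n ω, D n ω ≤ 1) (n : ℕ) (s : ℝ) :
    StronglyMeasurable[ℱ n] (fun ω => Real.exp (s * centeredSum μ ℱ D n ω)) ∧
    (∀ᵐ ω ∂μ, ‖Real.exp (s * centeredSum μ ℱ D n ω)‖ ≤ Real.exp (|s| * n)) ∧
    Integrable (fun ω => Real.exp (s * centeredSum μ ℱ D n ω)) μ := by
  have hm : StronglyMeasurable[ℱ n] (fun ω => Real.exp (s * centeredSum μ ℱ D n ω)) :=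
    Real.continuous_exp.comp_stronglyMeasurable
      ((stronglyMeasurable_centeredSum hmono hD n).const_mul s)
  have hb : ∀ᵐ ω ∂μ, ‖Real.exp (s * centeredSum μ ℱ D n ω)‖ ≤ Real.exp (|s| * n) := by
    filter_upwards [abs_centeredSum_le (μ := μ) hle hD h0 h1 n] with ω h
    rw [Real.norm_eq_abs, Real.abs_exp]
    refine Real.exp_le_exp.2 ((le_abs_self _).trans ?_)
    rw [abs_mul]
    gcongr
  exact ⟨hm, hb, Integrable.of_bound (hm.mono (hle n)).aestronglyMeasurable _ hb⟩

lemma mgf_centeredSum_le (hmono : Monotone ℱ) (hle : ∀ n, ℱ n ≤ mΩ)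
    (hD : ∀ n, StronglyMeasurable[ℱ (n + 1)] (D n)) (h0 : ∀ n ω, 0 ≤ D n ω)
    (h1 : ∀ n ω, D n ω ≤ 1) {s : ℝ} (hs : |s| ≤ 1) (n : ℕ) :
    mgf (centeredSum μ ℱ D n) μ s ≤ Real.exp (s ^ 2 * n) := by
  induction n with
  | zero => simp [mgf, centeredSum]
  | succ n ih =>
    obtain ⟨hm, hb, hi⟩ := integrable_exp_mul_centeredSum (μ := μ) hmono hle hD h0 h1 n s
    obtain ⟨-, -, hi'⟩ := integrable_exp_mul_centeredSum (μ := μ) hmono hle hD h0 h1 (n + 1) s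
    set f : Ω → ℝ := fun ω => Real.exp (s * centeredSum μ ℱ D n ω) with hf
    have hDi := integrable_of_mem_Icc (μ := μ) hle hD h0 h1 n
    have hfD : Integrable (fun ω => f ω * D n ω) μ :=
      hDi.bdd_mul (hm.mono (hle n)).aestronglyMeasurable hb
    have hfq : Integrable (fun ω => f ω * (μ[D n | ℱ n]) ω) μ :=
      integrable_condExp.bdd_mul (hm.mono (hle n)).aestronglyMeasurable hb
    have hcenter : ∫ ω, f ω * D n ω ∂μ = ∫ ω, f ω * (μ[D n | ℱ n]) ω ∂μ := by
      have h := condExp_mul_of_stronglyMeasurable_left (μ := μ) hm hfD hDi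
      have h2 := integral_condExp (μ := μ) (hle n) (f := f * D n)
      rw [integral_congr_ae h] at h2
      exact h2.symm
    have hstep : ∀ᵐ ω ∂μ, Real.exp (s * centeredSum μ ℱ D (n + 1) ω)
        ≤ (1 + s ^ 2) * f ω + s * (f ω * D n ω - f ω * (μ[D n | ℱ n]) ω) := by
      filter_upwards [abs_sub_condExp_le_one (μ := μ) hle hD h0 h1 n] with ω h
      have e1 : centeredSum μ ℱ D (n + 1) ω
          = centeredSum μ ℱ D n ω + (D n ω - (μ[D n | ℱ n]) ω) :=
        Finset.sum_range_succ _ _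
      set ξ := D n ω - (μ[D n | ℱ n]) ω with hξ
      have hsξ : |s * ξ| ≤ 1 := by
        rw [abs_mul]; exact mul_le_one₀ hs (abs_nonneg _) h
      have e2 := (abs_le.1 (Real.abs_exp_sub_one_sub_id_le hsξ)).2
      have e3 : ξ ^ 2 ≤ 1 := by rwa [sq_le_one_iff_abs_le_one]
      have e4 : (s * ξ) ^ 2 ≤ s ^ 2 := by
        rw [mul_pow]; exact mul_le_of_le_one_right (sq_nonneg _) e3
      rw [e1, mul_add, Real.exp_add]
      calc f ω * Real.exp (s * ξ) ≤ f ω * (1 + s * ξ + s ^ 2) :=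
            mul_le_mul_of_nonneg_left (by linarith) (Real.exp_nonneg _)
        _ = _ := by rw [hξ]; ring
    have hi2 : Integrable (fun ω => (1 + s ^ 2) * f ω) μ := hi.const_mul _
    have hi3 : Integrable (fun ω => s * (f ω * D n ω - f ω * (μ[D n | ℱ n]) ω)) μ :=
      (hfD.sub hfq).const_mul _
    calc mgf (centeredSum μ ℱ D (n + 1)) μ s
        ≤ ∫ ω, ((1 + s ^ 2) * f ω + s * (f ω * D n ω - f ω * (μ[D n | ℱ n]) ω)) ∂μ :=
          integral_mono_ae hi' (hi2.add hi3) hstep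
      _ = (1 + s ^ 2) * mgf (centeredSum μ ℱ D n) μ s := by
          rw [integral_add hi2 hi3, integral_const_mul, integral_const_mul,
            integral_sub hfD hfq, hcenter]
          simp [mgf, hf]
      _ ≤ Real.exp (s ^ 2) * Real.exp (s ^ 2 * n) := by
          have := Real.add_one_le_exp (s ^ 2)
          gcongr
          · exact mgf_nonneg
          · linarith
      _ = _ := by rw [← Real.exp_add]; push_cast; congr 1; ring

lemma measureReal_abs_centeredSum_ge_le (hmono : Monotone ℱ) (hle : ∀ n, ℱ n ≤ mΩ)
    (hD : ∀ n, StronglyMeasurable[ℱ (n + 1)] (D n)) (h0 : ∀ n ω, 0 ≤ D n ω)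
    (h1 : ∀ n ω, D n ω ≤ 1) {s : ℝ} (hs0 : 0 ≤ s) (hs : s ≤ 1) (n : ℕ) (r : ℝ) :
    μ.real {ω | r ≤ |centeredSum μ ℱ D n ω|} ≤ 2 * Real.exp (-s * r + s ^ 2 * n) := by
  have hsub : {ω | r ≤ |centeredSum μ ℱ D n ω|}
      ⊆ {ω | r ≤ centeredSum μ ℱ D n ω} ∪ {ω | centeredSum μ ℱ D n ω ≤ -r} := by
    intro ω hω
    rcases le_abs.1 (show r ≤ |centeredSum μ ℱ D n ω| from hω) with h | h
    · exact Or.inl h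
    · exact Or.inr (show centeredSum μ ℱ D n ω ≤ -r by linarith)
  have hp := measure_ge_le_exp_mul_mgf (μ := μ) r hs0
    (integrable_exp_mul_centeredSum hmono hle hD h0 h1 n s).2.2
  have hm := measure_le_le_exp_mul_mgf (μ := μ) (-r) (neg_nonpos.2 hs0)
    (integrable_exp_mul_centeredSum hmono hle hD h0 h1 n (-s)).2.2
  have gp := mgf_centeredSum_le (μ := μ) hmono hle hD h0 h1 (s := s) (by rwa [abs_of_nonneg hs0]) n
  have gm := mgf_centeredSum_le (μ := μ) hmono hle hD h0 h1 (s := -s)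
    (by rwa [abs_neg, abs_of_nonneg hs0]) n
  calc μ.real {ω | r ≤ |centeredSum μ ℱ D n ω|}
      ≤ μ.real {ω | r ≤ centeredSum μ ℱ D n ω} + μ.real {ω | centeredSum μ ℱ D n ω ≤ -r} :=
        (measureReal_mono hsub).trans (measureReal_union_le _ _)
    _ ≤ Real.exp (-s * r) * Real.exp (s ^ 2 * n)
        + Real.exp (-(-s) * (-r)) * Real.exp ((-s) ^ 2 * n) := by
        refine add_le_add (hp.trans ?_) (hm.trans ?_)
        · gcongr
        · gcongr
    _ = _ := by rw [← Real.exp_add, ← Real.exp_add, two_mul]; congr 2; ring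

lemma ae_eventually_abs_centeredSum_lt {ι : Type*} [Fintype ι] [DecidableEq ι]
    {ℱ : (ι → ℕ) → ℕ → MeasurableSpace Ω} {D : (ι → ℕ) → ι → ℕ → Ω → ℝ}
    (hmono : ∀ x, Monotone (ℱ x)) (hle : ∀ x n, ℱ x n ≤ mΩ)
    (hD : ∀ x i n, StronglyMeasurable[ℱ x (n + 1)] (D x i n)) (h0 : ∀ x i n ω, 0 ≤ D x i n ω)
    (h1 : ∀ x i n ω, D x i n ω ≤ 1) {ε : ℝ} (hε : 0 < ε) (T : ℕ) :
    ∀ᵐ ω ∂μ, ∀ᶠ m : ℕ in atTop, ∀ x, size x = m → ∀ i, ∀ k ≤ T * m,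
      |centeredSum μ (ℱ x) (D x i) k ω| < ε * m := by
  set s : ℝ := min 1 (ε / (2 * (T + 1))) with hs
  have hs0 : 0 < s := by positivity
  have hs1 : s ≤ 1 := min_le_left _ _
  have hsT : s * T ≤ ε / 2 := by
    have h : s ≤ ε / (2 * (T + 1)) := min_le_right _ _
    rw [le_div_iff₀ (by positivity)] at h
    linarith
  set c : ℝ := s * ε / 2 with hc
  have hc0 : 0 < c := by positivity
  set K := Fintype.card ι with hK
  set J : ℕ → Finset ((ι → ℕ) × ι × ℕ) := fun m =>
    (Fintype.piFinset fun _ => Finset.range (m + 1)) ×ˢ Finset.univ ×ˢ Finset.range (T * m + 1)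
    with hJ
  have hJcard : ∀ m, (J m).card = (m + 1) ^ K * (K * (T * m + 1)) := by
    intro m
    simp [hJ, hK]
  set bad : ℕ → Set Ω := fun m =>
    ⋃ p ∈ J m, {ω | ε * m ≤ |centeredSum μ (ℱ p.1) (D p.1 p.2.1) p.2.2 ω|} with hbad
  have hbound : ∀ m : ℕ, μ.real (bad m)
      ≤ (2 * K * (T + 1) * Real.exp c) *
        (((m + 1 : ℕ) : ℝ) ^ (K + 1) * Real.exp (-c * ((m + 1 : ℕ) : ℝ))) := by
    intro m
    have hone : ∀ p ∈ J m, μ.real {ω | ε * m ≤ |centeredSum μ (ℱ p.1) (D p.1 p.2.1) p.2.2 ω|}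
        ≤ 2 * Real.exp (-c * m) := by
      intro p hp
      have hk : p.2.2 ≤ T * m := by
        simp only [hJ, Finset.mem_product, Finset.mem_range] at hp
        omega
      have hk' : (p.2.2 : ℝ) ≤ T * m := by exact_mod_cast hk
      refine (measureReal_abs_centeredSum_ge_le (hmono p.1) (hle p.1) (hD p.1 p.2.1)
        (h0 p.1 p.2.1) (h1 p.1 p.2.1) hs0.le hs1 p.2.2 (ε * m)).trans ?_
      gcongr
      have e1 : s ^ 2 * (p.2.2 : ℝ) ≤ s ^ 2 * (T * m) := by gcongr
      have e2 : s * T * (s * m) ≤ ε / 2 * (s * m) := by gcongr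
      rw [hc]
      linarith
    calc μ.real (bad m) ≤ ∑ p ∈ J m, 2 * Real.exp (-c * m) :=
          (measureReal_biUnion_finset_le _ _).trans (Finset.sum_le_sum hone)
      _ = ((m + 1) ^ K * (K * (T * m + 1))) * (2 * Real.exp (-c * m)) := by
          rw [Finset.sum_const, hJcard, nsmul_eq_mul]; push_cast; rfl
      _ ≤ ((m + 1) ^ K * (K * ((T + 1) * (m + 1)))) * (2 * Real.exp (-c * m)) := by
          gcongr
          have : (0 : ℝ) ≤ T := Nat.cast_nonneg _
          have : (0 : ℝ) ≤ m := Nat.cast_nonneg _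
          nlinarith
      _ = _ := by
          have : Real.exp (-c * m) = Real.exp c * Real.exp (-c * ((m + 1 : ℕ) : ℝ)) := by
            rw [← Real.exp_add]; push_cast; congr 1; ring
          rw [this]; push_cast; ring
  have hsummable : Summable fun m => μ.real (bad m) := by
    refine Summable.of_nonneg_of_le (fun _ => measureReal_nonneg) hbound (Summable.mul_left _ ?_)
    exact (summable_nat_add_iff (f := fun n : ℕ => (n : ℝ) ^ (K + 1) * Real.exp (-c * n)) 1).2
      (Real.summable_pow_mul_exp_neg_nat_mul (K + 1) hc0)
  have htsum : ∑' m, μ (bad m) ≠ ∞ := by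
    have := hsummable.tsum_ofReal_ne_top
    simpa only [ofReal_measureReal (measure_ne_top μ _)] using this
  filter_upwards [ae_eventually_notMem htsum] with ω hω
  filter_upwards [hω] with m hm x hx i k hk
  by_contra! hcon
  refine hm (Set.mem_iUnion₂.2 ⟨(x, i, k), ?_, hcon⟩)
  simp only [hJ, Finset.mem_product, Fintype.mem_piFinset, Finset.mem_range, Finset.mem_univ,
    true_and]
  refine ⟨fun j => ?_, by omega⟩
  have : x j ≤ size x := Finset.single_le_sum (f := x) (fun _ _ => Nat.zero_le _) (Finset.mem_univ j)
  omega

lemma eventually_abs_sub_mul_le_of_tendsto_div {S : ℕ → ℝ} {c : ℝ}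
    (h : Tendsto (fun n : ℕ => S n / n) atTop (𝓝 c)) (h0 : S 0 = 0) {ε : ℝ} (hε : 0 < ε) (T : ℕ) :
    ∀ᶠ m : ℕ in atTop, ∀ k ≤ T * m, |S k - c * k| ≤ ε * m := by
  have h1 : ∀ᶠ n : ℕ in atTop, |S n / n - c| < ε / (T + 1) := by
    have := Metric.tendsto_nhds.1 h (ε / (T + 1)) (by positivity)
    simpa [Real.dist_eq] using this
  obtain ⟨k₀, hk₀⟩ := eventually_atTop.1 h1
  set C : ℝ := ∑ k ∈ Finset.range k₀, |S k - c * k| with hC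
  have h2 : ∀ᶠ m : ℕ in atTop, C / ε ≤ m := tendsto_natCast_atTop_atTop.eventually_ge_atTop _
  filter_upwards [h2] with m hm k hk
  rw [div_le_iff₀ hε] at hm
  rcases lt_or_ge k k₀ with hlt | hge
  · have : |S k - c * k| ≤ C :=
      Finset.single_le_sum (f := fun k : ℕ => |S k - c * k|) (fun _ _ => abs_nonneg _)
        (Finset.mem_range.2 hlt)
    linarith
  · rcases Nat.eq_zero_or_pos k with rfl | hpos
    · simp only [h0, Nat.cast_zero, mul_zero, sub_zero, abs_zero]; positivity
    have hk0 : (0 : ℝ) < k := by exact_mod_cast hpos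
    have h3 : S k - c * k = (S k / k - c) * k := by field_simp
    have h4 : (k : ℝ) ≤ T * m := by exact_mod_cast hk
    have hm0 : (0 : ℝ) ≤ m := Nat.cast_nonneg _
    rw [h3, abs_mul, abs_of_pos hk0]
    calc |S k / k - c| * k ≤ ε / (T + 1) * (T * m) :=
          mul_le_mul (hk₀ k hge).le h4 hk0.le (by positivity)
      _ ≤ ε / (T + 1) * ((T + 1) * m) := by gcongr; linarith
      _ = ε * m := by field_simp

end Concentration
section Attempts

variable {ι : Type*} [Fintype ι] [DecidableEq ι] (G : SimpleGraph ι) [DecidableRel G.Adj]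

lemma success_le_one (m : ι → ℕ) (i : ι) : success G m i ≤ 1 := by
  unfold success; split_ifs <;> simp

/-- The numbers of attempts, bounded by `R`, for which the transmission at `i` succeeds. -/
def successBox (R : ℕ) (i : ι) : Finset (ι → ℕ) :=
  Fintype.piFinset fun j => if j = i then {1} else if j ∈ nbhd G i then {0} else Finset.range (R + 1)

lemma success_eq_one_of_mem_successBox {R : ℕ} {i : ι} {m : ι → ℕ} (hm : m ∈ successBox G R i) :
    success G m i = 1 := by
  rw [successBox, Fintype.mem_piFinset] at hm
  unfold success
  rw [if_pos]
  refine ⟨by simpa using hm i, fun j hj => ?_⟩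
  simp only [Finset.mem_sdiff, Finset.mem_singleton] at hj
  simpa [hj.1, hj.2] using hm j

lemma sum_binomialWeight {n R : ℕ} (h : n ≤ R) (p : ℝ) :
    ∑ k ∈ Finset.range (R + 1), binomialWeight n p k = 1 := by
  have h1 : ∑ k ∈ Finset.range (n + 1), binomialWeight n p k = 1 := by
    have := add_pow p (1 - p) n
    rw [add_sub_cancel, one_pow] at this
    rw [this]
    exact Finset.sum_congr rfl fun k _ => by unfold binomialWeight; ring
  rw [← h1]
  symm
  refine Finset.sum_subset (Finset.range_mono (by omega)) fun k _ hk => ?_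
  have : n < k := by simpa using hk
  simp [binomialWeight, Nat.choose_eq_zero_of_lt this]

lemma sum_successBox {w : ι → ℕ} {R : ℕ} (hw : ∀ j, w j ≤ R) (i : ι) :
    ∑ m ∈ successBox G R i, ∏ j, binomialWeight (w j) (attemptProb G w j) (m j)
      = successProb G w i := by
  rw [successBox, ← Finset.prod_univ_sum, successProb]
  have h1 : ∏ j, ∑ k ∈ (if j = i then {1} else if j ∈ nbhd G i then {0} else
      Finset.range (R + 1) : Finset ℕ), binomialWeight (w j) (attemptProb G w j) k
      = ∏ j ∈ nbhd G i, ∑ k ∈ (if j = i then {1} else if j ∈ nbhd G i then {0} else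
      Finset.range (R + 1) : Finset ℕ), binomialWeight (w j) (attemptProb G w j) k := by
    symm
    refine Finset.prod_subset (Finset.subset_univ _) fun j _ hj => ?_
    have hji : j ≠ i := fun h => hj (h ▸ mem_nbhd_self G i)
    simp only [hji, hj, if_false]
    exact sum_binomialWeight (hw j) _
  rw [h1, ← Finset.insert_erase (mem_nbhd_self G i), Finset.prod_insert (Finset.notMem_erase _ _),
    Finset.insert_erase (mem_nbhd_self G i), Finset.sdiff_singleton_eq_erase]
  congr 1
  · simp
  · refine Finset.prod_congr rfl fun j hj => ?_
    simp [Finset.ne_of_mem_erase hj, Finset.mem_of_mem_erase hj]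

end Attempts

section Model

variable {ι : Type*} [Fintype ι] [DecidableEq ι] {G : SimpleGraph ι} [DecidableRel G.Adj]
  {Ω : Type*} [mΩ : MeasurableSpace Ω] {μ : Measure Ω} {lam : ι → ℝ}
  {A : ℕ → Ω → ι → ℕ} {N : (ι → ℕ) → ℕ → Ω → ι → ℕ}

lemma history_mono (x : ι → ℕ) : Monotone (history A N x) := by
  intro n k hnk
  refine sup_le_sup ?_ ?_
  · exact biSup_mono fun l hl => ⟨hl.1, hl.2.trans hnk⟩
  · exact biSup_mono fun l hl => lt_of_lt_of_le hl hnk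

lemma history_le (h : IsModel G lam μ A N) (x : ι → ℕ) (n : ℕ) : history A N x n ≤ mΩ := by
  refine sup_le (iSup₂_le fun k _ => ?_) (iSup₂_le fun k _ => ?_)
  · exact (h.measurable_arrivals k).comap_le
  · exact (h.measurable_attempts x k).comap_le

lemma measurable_arrivals_history (x : ι → ℕ) {k n : ℕ} (h1 : 1 ≤ k) (hk : k ≤ n) :
    Measurable[history A N x n] (A k) :=
  Measurable.of_comap_le (le_trans (le_iSup₂ (f := fun k (_ : k ∈ Set.Icc 1 n) =>
    MeasurableSpace.comap (A k) inferInstance) k ⟨h1, hk⟩) le_sup_left)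

lemma measurable_attempts_history (x : ι → ℕ) {k n : ℕ} (hk : k < n) :
    Measurable[history A N x n] (N x k) :=
  Measurable.of_comap_le (le_trans (le_iSup₂ (f := fun k (_ : k ∈ Set.Iio n) =>
    MeasurableSpace.comap (N x k) inferInstance) k hk) le_sup_right)

lemma measurable_W_history (x : ι → ℕ) (n : ℕ) : Measurable[history A N x n] (W G A N x n) := by
  induction n with
  | zero => exact measurable_const
  | succ n ih =>
    have h1 : Measurable[history A N x (n + 1)] (W G A N x n) :=
      ih.mono (history_mono x (Nat.le_succ n)) le_rfl
    have h2 := measurable_arrivals_history (A := A) (N := N) x (Nat.succ_pos n) le_rfl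
    have h3 := measurable_attempts_history (A := A) (N := N) x (Nat.lt_succ_self n)
    have h4 : Measurable (fun p : (ι → ℕ) × (ι → ℕ) × (ι → ℕ) =>
        fun i => p.1 i + p.2.1 i - success G p.2.2 i) := Measurable.of_discrete
    exact h4.comp (h1.prodMk (h2.prodMk h3))

/-- The indicator of a successful transmission at `i` at time `n`. -/
def departure (G : SimpleGraph ι) [DecidableRel G.Adj] (N : (ι → ℕ) → ℕ → Ω → ι → ℕ) (x : ι → ℕ)
    (i : ι) (n : ℕ) (ω : Ω) : ℝ := success G (N x n ω) i

lemma departure_nonneg (x : ι → ℕ) (i : ι) (n : ℕ) (ω : Ω) : 0 ≤ departure G N x i n ω :=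
  Nat.cast_nonneg _

lemma departure_le_one (x : ι → ℕ) (i : ι) (n : ℕ) (ω : Ω) : departure G N x i n ω ≤ 1 := by
  unfold departure; exact_mod_cast success_le_one G _ _

lemma stronglyMeasurable_departure (x : ι → ℕ) (i : ι) (n : ℕ) :
    StronglyMeasurable[history A N x (n + 1)] (departure G N x i n) := by
  refine Measurable.stronglyMeasurable ?_
  have h : Measurable (fun m : ι → ℕ => (success G m i : ℝ)) := Measurable.of_discrete
  exact h.comp (measurable_attempts_history (A := A) (N := N) x (Nat.lt_succ_self n))

variable [IsProbabilityMeasure μ]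

lemma integrable_indicator_attempts (h : IsModel G lam μ A N) (x : ι → ℕ) (n : ℕ) (m : ι → ℕ) :
    Integrable ((N x n ⁻¹' {m}).indicator (fun _ => (1 : ℝ))) μ :=
  (integrable_const 1).indicator (h.measurable_attempts x n (measurableSet_singleton m))

lemma successProb_le_condExp_departure (h : IsModel G lam μ A N) (x : ι → ℕ) (i : ι) (n : ℕ) :
    ∀ᵐ ω ∂μ, successProb G (W G A N x n ω) i
      ≤ (μ[departure G N x i n | history A N x n]) ω := by
  have hbox : ∀ R : ℕ, ∀ᵐ ω ∂μ, ∑ m ∈ successBox G R i,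
      ∏ j, binomialWeight (W G A N x n ω j) (attemptProb G (W G A N x n ω) j) (m j)
      ≤ (μ[departure G N x i n | history A N x n]) ω := by
    intro R
    have hsum := condExp_finsetSum (μ := μ) (s := successBox G R i)
      (f := fun m => (N x n ⁻¹' {m}).indicator (fun _ => (1 : ℝ)))
      (fun m _ => integrable_indicator_attempts h x n m) (history A N x n)
    have hle : (∑ m ∈ successBox G R i, (N x n ⁻¹' {m}).indicator (fun _ => (1 : ℝ)))
        ≤ᵐ[μ] departure G N x i n := by
      refine Eventually.of_forall fun ω => ?_
      simp only [Finset.sum_apply]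
      by_cases hm : N x n ω ∈ successBox G R i
      · rw [Finset.sum_eq_single (N x n ω)]
        · rw [departure, success_eq_one_of_mem_successBox G hm]
          simp
        · intro m _ hne
          simp [Set.indicator, Ne.symm hne]
        · exact fun hn => absurd hm hn
      · rw [Finset.sum_eq_zero]
        · exact departure_nonneg _ _ _ _
        · intro m hm'
          have : N x n ω ≠ m := fun he => hm (he ▸ hm')
          simp [Set.indicator, this]
    have hmono := condExp_mono (m := history A N x n)
      (integrable_finsetSum' _ fun m _ => integrable_indicator_attempts h x n m)
      (integrable_of_mem_Icc (history_le h x) (stronglyMeasurable_departure x i)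
        (departure_nonneg x i) (departure_le_one x i) n) hle
    have hlaw := ae_all_iff.2 fun m => h.attempts_law x n m
    filter_upwards [hsum, hmono, hlaw] with ω e1 e2 e3
    rw [e1] at e2
    refine le_trans (le_of_eq ?_) e2
    rw [Finset.sum_apply]
    exact Finset.sum_congr rfl fun m _ => (e3 m).symm
  filter_upwards [ae_all_iff.2 hbox] with ω hω
  have hR : ∀ j, W G A N x n ω j ≤ size (W G A N x n ω) := fun j =>
    Finset.single_le_sum (f := W G A N x n ω) (fun _ _ => Nat.zero_le _) (Finset.mem_univ j)
  rw [← sum_successBox G hR i]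
  exact hω _

lemma ae_pos_of_success (h : IsModel G lam μ A N) (x : ι → ℕ) (i : ι) (n : ℕ) :
    ∀ᵐ ω ∂μ, success G (N x n ω) i ≤ W G A N x n ω i := by
  have hm : ∀ m : ι → ℕ, m i = 1 → ∀ᵐ ω ∂μ, W G A N x n ω i = 0 → N x n ω ≠ m := by
    intro m hmi
    set B : Set Ω := {ω | W G A N x n ω i = 0} with hB
    have hBm : MeasurableSet[history A N x n] B := by
      have h1 : Measurable (fun w : ι → ℕ => w i) := Measurable.of_discrete
      exact (h1.comp (measurable_W_history x n)) (measurableSet_singleton 0)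
    have hint := setIntegral_condExp (history_le h x n)
      (integrable_indicator_attempts h x n m) hBm
    have hzero : ∫ ω in B, (μ[(N x n ⁻¹' {m}).indicator (fun _ => (1 : ℝ)) | history A N x n]) ω ∂μ
        = 0 := by
      refine setIntegral_eq_zero_of_ae_eq_zero ?_
      filter_upwards [h.attempts_law x n m] with ω hω hωB
      rw [hω]
      refine Finset.prod_eq_zero (Finset.mem_univ i) ?_
      have : W G A N x n ω i = 0 := hωB
      simp [binomialWeight, this, hmi]
    rw [hzero, setIntegral_indicator (h.measurable_attempts x n (measurableSet_singleton m))] at hint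
    simp only [integral_const, smul_eq_mul, mul_one, measureReal_restrict_apply_univ] at hint
    have h0 : μ (B ∩ N x n ⁻¹' {m}) = 0 := by
      rwa [eq_comm, measureReal_eq_zero_iff] at hint
    rw [ae_iff]
    convert h0 using 2
    ext ω
    simp [hB]
  have hall : ∀ᵐ ω ∂μ, ∀ m : ι → ℕ, m i = 1 → W G A N x n ω i = 0 → N x n ω ≠ m :=
    ae_all_iff.2 fun m => by
      by_cases hmi : m i = 1
      · filter_upwards [hm m hmi] with ω hω _ using hω
      · exact Eventually.of_forall fun ω hc => absurd hc hmi
  filter_upwards [hall] with ω hω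
  rcases Nat.eq_zero_or_pos (W G A N x n ω i) with h0 | h0
  · have : N x n ω i ≠ 1 := fun hN => hω _ hN h0 rfl
    simp [success, this]
  · exact (success_le_one G _ _).trans h0

lemma W_eq_of_success_le {x : ι → ℕ} {ω : Ω}
    (h : ∀ n i, success G (N x n ω) i ≤ W G A N x n ω i) (n : ℕ) (i : ι) :
    (W G A N x n ω i : ℝ) = x i + ∑ l ∈ Finset.range n, (A (l + 1) ω i : ℝ)
      - ∑ l ∈ Finset.range n, departure G N x i l ω := by
  induction n with
  | zero => simp [W, workload]
  | succ n ih =>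
    have h1 : W G A N x (n + 1) ω i = W G A N x n ω i + A (n + 1) ω i - success G (N x n ω) i := rfl
    rw [h1, Nat.cast_sub ((h n i).trans (Nat.le_add_right _ _)), Nat.cast_add, ih,
      Finset.sum_range_succ, Finset.sum_range_succ, departure]
    ring

lemma ae_eventually_abs_sum_arrivals_sub_le (h : IsModel G lam μ A N) {ε : ℝ} (hε : 0 < ε)
    (T : ℕ) : ∀ᵐ ω ∂μ, ∀ᶠ m : ℕ in atTop, ∀ i, ∀ k ≤ T * m,
      |∑ l ∈ Finset.range k, (A (l + 1) ω i : ℝ) - lam i * k| ≤ ε * m := by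
  have hi : ∀ i, ∀ᵐ ω ∂μ, Tendsto
      (fun n : ℕ => (∑ l ∈ Finset.range n, (A (l + 1) ω i : ℝ)) / n) atTop (𝓝 (lam i)) := by
    intro i
    have hg : Measurable (fun a : ι → ℕ => (a i : ℝ)) := Measurable.of_discrete
    have := strong_law_ae_real (μ := μ) (fun l ω => (A (l + 1) ω i : ℝ))
      (h.integrable_arrivals 1 i)
      (fun k l hkl => (h.indep_arrivals.indepFun (by simpa using hkl)).comp hg hg)
      (fun l => ((h.ident_arrivals (l + 1)).trans (h.ident_arrivals 1).symm).comp hg)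
    rwa [h.mean_arrivals 1 i] at this
  filter_upwards [ae_all_iff.2 hi] with ω hω
  exact eventually_all.2 fun i =>
    eventually_abs_sub_mul_le_of_tendsto_div
      (S := fun k => ∑ l ∈ Finset.range k, (A (l + 1) ω i : ℝ)) (hω i) (by simp) hε T

lemma ae_eventually_abs_W_sub_le (h : IsModel G lam μ A N) {ε : ℝ} (hε : 0 < ε) (T : ℕ) :
    ∀ᵐ ω ∂μ, ∀ᶠ m : ℕ in atTop, ∀ x, size x = m → ∀ k ≤ T * m, ∀ i,
      |(W G A N x k ω i : ℝ) - (x i + lam i * k -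
        ∑ l ∈ Finset.range k, (μ[departure G N x i l | history A N x l]) ω)| ≤ ε * m := by
  have hsucc : ∀ᵐ ω ∂μ, ∀ x n i, success G (N x n ω) i ≤ W G A N x n ω i :=
    ae_all_iff.2 fun x => ae_all_iff.2 fun n => ae_all_iff.2 fun i => ae_pos_of_success h x i n
  filter_upwards [hsucc, ae_eventually_abs_sum_arrivals_sub_le h (half_pos hε) T,
    ae_eventually_abs_centeredSum_lt (μ := μ) (fun x => history_mono (A := A) (N := N) x)
      (fun x => history_le h x) (fun x i => stronglyMeasurable_departure (G := G) x i)
      (fun x i => departure_nonneg x i) (fun x i => departure_le_one x i) (half_pos hε) T]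
    with ω e1 e2 e3
  filter_upwards [e2, e3] with m e4 e5 x hx k hk i
  have e6 := e4 i k hk
  have e7 := (e5 x hx i k hk).le
  rw [W_eq_of_success_le (e1 x) k i]
  have e8 : centeredSum μ (history A N x) (departure G N x i) k ω
      = ∑ l ∈ Finset.range k, departure G N x i l ω
        - ∑ l ∈ Finset.range k, (μ[departure G N x i l | history A N x l]) ω :=
    Finset.sum_sub_distrib _ _
  rw [e8] at e7
  rw [abs_le] at e6 e7 ⊢
  constructor <;> linarith

end Model

section Emptying

variable {ι : Type*} [Fintype ι] [DecidableEq ι] {G : SimpleGraph ι} [DecidableRel G.Adj]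
  {Ω : Type*} [mΩ : MeasurableSpace Ω] {μ : Measure Ω} [IsProbabilityMeasure μ]
  {A : ℕ → Ω → ι → ℕ} {N : (ι → ℕ) → ℕ → Ω → ι → ℕ}

lemma ae_eventually_sum_W_le [Nonempty ι] {V : ℕ} (hV : ∀ i, (nbhd G i).card = V) {lam δ : ℝ}
    (hδ : 0 < δ) (hδV : δ = Real.exp (-1) - lam * V) (h : IsModel G (fun _ => lam) μ A N) :
    ∀ᵐ ω ∂μ, ∀ η : ℝ, 0 < η → ∀ T : ℕ, ∀ᶠ m : ℕ in atTop, ∀ x, size x = m → ∀ k ≤ T * m,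
      2 * m / δ ≤ k → ∑ i, (W G A N x k ω i : ℝ) ≤ η * m := by
  have hlam : 0 < lam := h.lam_pos (Classical.arbitrary ι)
  have hfix : ∀ η : ℝ, 0 < η → ∀ T : ℕ, ∀ᵐ ω ∂μ, ∀ᶠ m : ℕ in atTop, ∀ x, size x = m →
      ∀ k ≤ T * m, 2 * m / δ ≤ k → ∑ i, (W G A N x k ω i : ℝ) ≤ η * m := by
    intro η hη T
    obtain ⟨ε, hε, m₀, hm₀⟩ := exists_sum_le_of_fluid_approximation G hV hlam hδ hδV hη
    have hq : ∀ᵐ ω ∂μ, ∀ x i n, successProb G (W G A N x n ω) i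
        ≤ (μ[departure G N x i n | history A N x n]) ω :=
      ae_all_iff.2 fun x => ae_all_iff.2 fun i => ae_all_iff.2 fun n =>
        successProb_le_condExp_departure h x i n
    have hq1 : ∀ᵐ ω ∂μ, ∀ x i n, (μ[departure G N x i n | history A N x n]) ω ≤ 1 :=
      ae_all_iff.2 fun x => ae_all_iff.2 fun i => ae_all_iff.2 fun n =>
        condExp_le_one (history_le h x) (stronglyMeasurable_departure x i)
          (departure_nonneg x i) (departure_le_one x i) n
    filter_upwards [hq, hq1, ae_eventually_abs_W_sub_le h hε T] with ω e1 e2 e3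
    filter_upwards [e3, eventually_ge_atTop m₀] with m e4 hm x hx
    exact hm₀ m hm (fun k => W G A N x k ω)
      (fun l i => (μ[departure G N x i l | history A N x l]) ω) (T * m) hx
      (fun l _ i => e2 x i l) (fun l _ i => e1 x i l) (e4 x hx)
  have hcount : ∀ᵐ ω ∂μ, ∀ j T : ℕ, ∀ᶠ m : ℕ in atTop, ∀ x, size x = m →
      ∀ k ≤ T * m, 2 * m / δ ≤ k → ∑ i, (W G A N x k ω i : ℝ) ≤ 1 / ((j : ℝ) + 1) * m :=
    ae_all_iff.2 fun j => ae_all_iff.2 fun T => hfix _ (by positivity) T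
  filter_upwards [hcount] with ω hω η hη T
  obtain ⟨j, hj⟩ := exists_nat_one_div_lt hη
  filter_upwards [hω j T] with m hm x hx k hk hkδ
  exact (hm x hx k hk hkδ).trans (by gcongr)

end Emptying

end SpatialAloha

namespace SkorokhodPath

variable {ι : Type*} [Fintype ι]

/-- The paths that exceed the level `η` at some time in `(τ, T)`. -/
def exceedSet (τ T : ℝ≥0) (η : ℝ) : Set (SkorokhodPath ι) :=
  {f | ∃ t, τ < t ∧ t < T ∧ ∃ i, η < |f t i|}

lemma squash_pos {r : ℝ} (hr : 0 < r) : 0 < squash (ENNReal.ofReal r) := by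
  rw [squash_of_ne_top ENNReal.ofReal_ne_top, ENNReal.ofReal_pos, ENNReal.toReal_ofReal hr.le]
  positivity

lemma distOn_lt_of_edist_lt {f₁ f₂ : SkorokhodPath ι} {n : ℕ} {r : ℝ≥0∞}
    (h : edist f₁ f₂ < (2⁻¹ : ℝ≥0∞) ^ (n + 1) * squash r) :
    distOn ((n : ℝ≥0) + 1) f₁ f₂ < r := by
  by_contra! hr
  refine absurd h (not_lt.2 (le_trans ?_ (ENNReal.le_tsum n)))
  gcongr
  exact squash_mono hr

lemma isOpen_exceedSet (τ T : ℝ≥0) (η : ℝ) : IsOpen (exceedSet τ T η : Set (SkorokhodPath ι)) := by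
  rw [EMetric.isOpen_iff]
  rintro f ⟨t, hτ, hT, i, hi⟩
  set r : ℝ := min ((t : ℝ) - τ) (min ((T : ℝ) - t) (|f t i| - η)) with hr
  have hr0 : 0 < r :=
    lt_min (sub_pos.2 (by exact_mod_cast hτ)) (lt_min (sub_pos.2 (by exact_mod_cast hT)) (sub_pos.2 hi))
  have hr1 : r ≤ (t : ℝ) - τ := min_le_left _ _
  have hr2 : r ≤ (T : ℝ) - t := (min_le_right _ _).trans (min_le_left _ _)
  have hr3 : r ≤ |f t i| - η := (min_le_right _ _).trans (min_le_right _ _)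
  obtain ⟨n, hn⟩ := exists_nat_ge t
  refine ⟨(2⁻¹ : ℝ≥0∞) ^ (n + 1) * squash (ENNReal.ofReal r),
    ENNReal.mul_pos (by simp) (squash_pos hr0).ne', fun f' hf' => ?_⟩
  have hd := distOn_lt_of_edist_lt (show edist f' f < _ from hf')
  obtain ⟨g, hg⟩ := iInf_lt_iff.1 hd
  set t' : Set.Icc (0 : ℝ≥0) ((n : ℝ≥0) + 1) := ⟨t, zero_le, hn.trans (le_add_of_nonneg_right zero_le_one)⟩
  have h1 := (le_iSup (fun t : Set.Icc (0 : ℝ≥0) ((n : ℝ≥0) + 1) => ENNReal.ofReal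
    (|(((g t : ℝ≥0) : ℝ) - ((t : ℝ≥0) : ℝ))| + ∑ i, |f' (g t) i - f t i|)) t').trans_lt hg
  rw [ENNReal.ofReal_lt_ofReal_iff hr0] at h1
  have h2 : |f' (g t') i - f t i| ≤ ∑ i, |f' (g t') i - f t i| :=
    Finset.single_le_sum (f := fun i => |f' (g t') i - f t i|) (fun _ _ => abs_nonneg _)
      (Finset.mem_univ i)
  have h3 : |(((g t' : ℝ≥0) : ℝ) - (t : ℝ))| < r := by
    have := abs_nonneg (f' (g t') i - f t i)
    exact lt_of_le_of_lt (le_add_of_nonneg_right (this.trans h2)) h1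
  have h4 : |f' (g t') i - f t i| < r := by
    have := abs_nonneg (((g t' : ℝ≥0) : ℝ) - (t : ℝ))
    exact lt_of_le_of_lt (h2.trans (le_add_of_nonneg_left this)) h1
  have h5 := abs_lt.1 h3
  have h6 := abs_sub_abs_le_abs_sub (f t i) (f' (g t') i)
  rw [abs_sub_comm] at h6
  refine ⟨g t', ?_, ?_, i, by linarith⟩
  · have : (τ : ℝ) < (g t' : ℝ≥0) := by linarith [h5.1]
    exact_mod_cast this
  · have : ((g t' : ℝ≥0) : ℝ) < T := by linarith [h5.2]
    exact_mod_cast this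

lemma eq_zero_of_forall_notMem_exceedSet {τ : ℝ≥0} {f : SkorokhodPath ι}
    (h : ∀ T j : ℕ, f ∉ exceedSet τ T (1 / ((j : ℝ) + 1))) {t : ℝ≥0} (ht : τ < t) (i : ι) :
    f t i = 0 := by
  by_contra hne
  obtain ⟨j, hj⟩ := exists_nat_one_div_lt (abs_pos.2 hne)
  obtain ⟨T, hT⟩ := exists_nat_gt t
  exact h T j ⟨t, ht, hT, i, hj⟩

end SkorokhodPath

lemma tendsto_measure_zero_of_ae_eventually_notMem {Ω : Type*} [MeasurableSpace Ω] {μ : Measure Ω}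
    [IsFiniteMeasure μ] {s : ℕ → Set Ω} (hs : ∀ n, NullMeasurableSet (s n) μ)
    (h : ∀ᵐ ω ∂μ, ∀ᶠ n in atTop, ω ∉ s n) : Tendsto (fun n => μ (s n)) atTop (𝓝 0) := by
  have h1 : Tendsto (fun n => μ (⋃ k ≥ n, s k)) atTop (𝓝 (μ (⋂ n, ⋃ k ≥ n, s k))) :=
    tendsto_measure_iInter_atTop
      (fun n => NullMeasurableSet.iUnion fun k => NullMeasurableSet.iUnion fun _ => hs k)
      (fun m n hmn => Set.biUnion_mono (fun k hk => le_trans hmn hk) fun _ _ => le_rfl)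
      ⟨0, measure_ne_top _ _⟩
  have h2 : μ (⋂ n, ⋃ k ≥ n, s k) = 0 := by
    refine measure_mono_null ?_ (ae_iff.1 h)
    intro ω hω
    simp only [Set.mem_iInter, Set.mem_iUnion] at hω
    simp only [Set.mem_ofPred_eq, eventually_atTop, not_exists, not_forall, not_not]
    intro n
    obtain ⟨k, hk, hk'⟩ := hω n
    exact ⟨k, hk, hk'⟩
  rw [h2] at h1
  exact tendsto_of_tendsto_of_tendsto_of_le_of_le tendsto_const_nhds h1 (fun _ => zero_le)
    fun n => measure_mono (Set.subset_biUnion_of_mem (u := s) (le_refl n))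

namespace SpatialAloha

variable {ι : Type*} [Fintype ι] [DecidableEq ι] {G : SimpleGraph ι} [DecidableRel G.Adj]
  {Ω : Type*} [MeasurableSpace Ω] {μ : Measure Ω} [IsProbabilityMeasure μ]
  {A : ℕ → Ω → ι → ℕ} {N : (ι → ℕ) → ℕ → Ω → ι → ℕ}

lemma ae_eventually_scaledPath_notMem_exceedSet [Nonempty ι] {V : ℕ}
    (hV : ∀ i, (nbhd G i).card = V) {lam δ : ℝ} (hδ : 0 < δ) (hδV : δ = Real.exp (-1) - lam * V)
    (h : IsModel G (fun _ => lam) μ A N) :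
    ∀ᵐ ω ∂μ, ∀ x : ℕ → ι → ℕ, Tendsto (fun n => size (x n)) atTop atTop →
      ∀ T j : ℕ, ∀ᶠ n in atTop, scaledPath G A N (x n) ω
        ∉ SkorokhodPath.exceedSet (2 / δ).toNNReal T (1 / ((j : ℝ) + 1)) := by
  filter_upwards [ae_eventually_sum_W_le hV hδ hδV h] with ω hω x hx T j
  have hη : (0 : ℝ) < 1 / ((j : ℝ) + 1) := by positivity
  filter_upwards [hx.eventually (hω _ hη T), hx.eventually_gt_atTop 0] with n hn hpos
  rintro ⟨t, ht1, ht2, i, hi⟩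
  have hm : (0 : ℝ) < size (x n) := by exact_mod_cast hpos
  have hk := hn (x n) rfl ⌈(size (x n) : ℝ≥0) * t⌉₊
    (Nat.ceil_le.2 (by push_cast; rw [mul_comm]; gcongr))
    (by
      have h1 : ((size (x n) : ℝ≥0) * t : ℝ≥0) ≤ (⌈(size (x n) : ℝ≥0) * t⌉₊ : ℝ≥0) :=
        Nat.le_ceil _
      have h2 : (size (x n) : ℝ) * t ≤ (⌈(size (x n) : ℝ≥0) * t⌉₊ : ℝ) := by exact_mod_cast h1
      have h3 : 2 / δ < t := (Real.toNNReal_lt_iff_lt_coe (by positivity)).1 ht1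
      refine le_trans ?_ h2
      calc 2 * (size (x n) : ℝ) / δ = size (x n) * (2 / δ) := by ring
        _ ≤ _ := by gcongr)
  have hle : (W G A N (x n) ⌈(size (x n) : ℝ≥0) * t⌉₊ ω i : ℝ)
      ≤ ∑ i, (W G A N (x n) ⌈(size (x n) : ℝ≥0) * t⌉₊ ω i : ℝ) :=
    Finset.single_le_sum
      (f := fun i => (W G A N (x n) ⌈(size (x n) : ℝ≥0) * t⌉₊ ω i : ℝ))
      (fun _ _ => Nat.cast_nonneg _) (Finset.mem_univ i)
  have hi' : 1 / ((j : ℝ) + 1)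
      < (W G A N (x n) ⌈(size (x n) : ℝ≥0) * t⌉₊ ω i : ℝ) / size (x n) := by
    rwa [scaledPath, abs_of_nonneg (by positivity)] at hi
  rw [lt_div_iff₀ hm] at hi'
  linarith

end SpatialAloha

theorem theorem2 {ι : Type*} [Fintype ι] [DecidableEq ι] (G : SimpleGraph ι) [DecidableRel G.Adj]
    (hG : G.Connected) (V : ℕ) (hV : ∀ i, (SpatialAloha.nbhd G i).card = V)
    (lam : ℝ) (hlam : lam < Real.exp (-1) / V)
    {Ω : Type*} [MeasurableSpace Ω] (μ : Measure Ω) [IsProbabilityMeasure μ]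
    (A : ℕ → Ω → ι → ℕ) (N : (ι → ℕ) → ℕ → Ω → ι → ℕ)
    (hmodel : SpatialAloha.IsModel G (fun _ => lam) μ A N) :
    ∃ t₀ : ℝ≥0, ∀ x : ℕ → ι → ℕ, Tendsto (fun n => SpatialAloha.size (x n)) atTop atTop →
      (∀ᵐ ω ∂μ, ∀ z : SkorokhodPath ι, SpatialAloha.IsSampleFluidLimit G A N x ω z →
        ∀ t, t₀ ≤ t → ∀ i, z t i = 0) ∧
      (∀ (Ω' : Type*) [MeasurableSpace Ω'] (μ' : Measure Ω') [IsProbabilityMeasure μ']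
        (z : Ω' → SkorokhodPath ι), SpatialAloha.IsFluidLimitInLaw G μ A N x μ' z →
        ∀ᵐ ω' ∂μ', ∀ t, t₀ ≤ t → ∀ i, z ω' t i = 0) := by
  have : Nonempty ι := hG.nonempty
  have hV0 : 0 < V := by
    rw [← hV (Classical.arbitrary ι)]
    exact Finset.card_pos.2 ⟨_, SpatialAloha.mem_nbhd_self G _⟩
  obtain ⟨δ, hδV⟩ : ∃ δ, δ = Real.exp (-1) - lam * V := ⟨_, rfl⟩
  have hδ : 0 < δ := by
    rw [lt_div_iff₀ (by exact_mod_cast hV0)] at hlam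
    linarith
  have hmain := SpatialAloha.ae_eventually_scaledPath_notMem_exceedSet hV hδ hδV hmodel
  refine ⟨(2 / δ).toNNReal + 1, fun x hx => ⟨?_, ?_⟩⟩
  · filter_upwards [hmain] with ω hω z hz t ht i
    refine SkorokhodPath.eq_zero_of_forall_notMem_exceedSet (fun T j hmem => ?_)
      (lt_of_lt_of_le (lt_add_of_pos_right _ one_pos) ht) i
    have h1 := hz.2.frequently ((SkorokhodPath.isOpen_exceedSet _ _ _).mem_nhds hmem)
    exact h1 (hω x hx T j)
  · rintro Ω' _ μ' _ z ⟨-, φ, hφ, hconv⟩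
    have hnull : ∀ T j : ℕ, ∀ᵐ ω' ∂μ',
        z ω' ∉ SkorokhodPath.exceedSet (2 / δ).toNNReal T (1 / ((j : ℝ) + 1)) := by
      intro T j
      have hopen := SkorokhodPath.isOpen_exceedSet (ι := ι) (2 / δ).toNNReal T (1 / ((j : ℝ) + 1))
      have hlim := ProbabilityMeasure.le_liminf_measure_open_of_tendsto hconv.tendsto hopen
      have hzero := tendsto_measure_zero_of_ae_eventually_notMem
        (fun k => (hconv.forall_aemeasurable k).nullMeasurable hopen.measurableSet)
        (by
          filter_upwards [hmain] with ω hω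
          exact hω (x ∘ φ) (hx.comp hφ.tendsto_atTop) T j)
      simp only [ProbabilityMeasure.coe_mk] at hlim
      rw [Measure.map_apply_of_aemeasurable hconv.aemeasurable_limit hopen.measurableSet] at hlim
      simp only [Measure.map_apply_of_aemeasurable (hconv.forall_aemeasurable _)
        hopen.measurableSet] at hlim
      rw [hzero.liminf_eq] at hlim
      exact measure_eq_zero_iff_ae_notMem.1 (le_antisymm hlim (zero_le))
    filter_upwards [ae_all_iff.2 fun T => ae_all_iff.2 fun j => hnull T j] with ω' hω' t ht i
    exact SkorokhodPath.eq_zero_of_forall_notMem_exceedSet hω'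
      (lt_of_lt_of_le (lt_add_of_pos_right _ one_pos) ht) i

end
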